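/- Let $(S,\mathfrak m)$ be a Noetherian local ring, let $M$ be a nonzero finitely generated $S$-module of Krull dimension $m$, and let $I\subsetneq S$ be a proper ideal with $\mathfrak m^nM\subseteq IM$ for some $n\ge 1$. Let $\operatorname{gr}_I(M)=\bigoplus_{n\ge 0}I^nM/I^{n+1}M$, with Hilbert function $H(n)=\ell_S(I^nM/I^{n+1}M)$ (length over $S$). The multiplicity $e(M,I)=e(\operatorname{gr}_I(M))$ is defined as $h(1)$, where $\sum_{n\ge 0}H(n)t^n=\dfrac{h(t)}{(1-t)^d}$ with $d\ge 0$, $h\in\mathbb Z[t]$ and $h(1)\ne 0$ (such $d$ and $h$ are unique if they exist, and $e(M,I)=0$ if they do not). Let $H_1(n)=\sum_{j=0}^nH(j)$ be the Hilbert–Samuel function, put $$\zeta^1_{M,I}(z,w)=\sum_{n=0}^{\infty}\frac{H_1(n)}{(n+w)^z}\qquad (w>0),$$ and let $$\zeta^1_{M,I}(z)=\lim_{w\searrow 0}\bigl(\zeta^1_{M,I}(z,w)-H(0)w^{-z}\bigr),$$ understood as the meromorphic continuation to $\mathbb C$ of the function so defined on a right half-plane in which the series converge. Then the values $H(n)$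 are all finite, the Hilbert series of $\operatorname{gr}_I(M)$ has the above form with $d=m$, the meromorphic function $\zeta^1_{M,I}$ on $\mathbb C$ exists (and is unique), and $$e(M,I)=m!\,\operatorname{Res}_{z=m+1}\zeta^1_{M,I}(z).$$ -/

import Mathlib

open scoped Topology

/-- The degree `n` component `IⁿM / Iⁿ⁺¹M` of the associated graded module `gr_I(M)`. -/
abbrev GrPiece {S : Type*} [CommRing S] (I : Ideal S) (M : Type*) [AddCommGroup M] [Module S M]
    (n : ℕ) : Type _ :=
  ↥(I ^ n • (⊤ : Submodule S M)) ⧸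
    (I ^ (n + 1) • (⊤ : Submodule S M)).submoduleOf (I ^ n • (⊤ : Submodule S M))

/-- The Hilbert function `n ↦ H(gr_I(M), n)`, the length of `IⁿM / Iⁿ⁺¹M`. -/
noncomputable def grHilbert {S : Type*} [CommRing S] (I : Ideal S) (M : Type*) [AddCommGroup M]
    [Module S M] (n : ℕ) : ℕ :=
  (Module.length S (GrPiece I M n)).toNat

/-- The iterated Hilbert functions: `H₀ = H` and `Hᵢ₊₁(n) = ∑_{j=0}^n Hᵢ(j)`. -/
def iteratedHilbert (H : ℕ → ℕ) : ℕ → ℕ → ℕ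
  | 0, n => H n
  | i + 1, n => ∑ j ∈ Finset.range (n + 1), iteratedHilbert H i j

/-- `∑ H(n) tⁿ = h(t) / (1 - t)^d` with `h ∈ ℤ[t]` and `h(1) ≠ 0`. The series determines both
`d` (the order of its pole at `t = 1`) and `h`. -/
def IsHilbertNumerator (H : ℕ → ℕ) (d : ℕ) (h : Polynomial ℤ) : Prop :=
  PowerSeries.mk (fun n => (H n : ℤ)) * (1 - PowerSeries.X) ^ d = (h : PowerSeries ℤ) ∧
    h.eval 1 ≠ 0

open Classical in
/-- The multiplicity `h(1)`, where `∑ H(n) tⁿ = h(t) / (1 - t)^d` and `h(1) ≠ 0`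
(and `0` if there is no such presentation, e.g. for `H = 0`). -/
noncomputable def hilbertMultiplicity (H : ℕ → ℕ) : ℤ :=
  if e : ∃ p : ℕ × Polynomial ℤ, IsHilbertNumerator H p.1 p.2 then e.choose.2.eval 1 else 0

/-- The multiplicity `e(M, I) = e(gr_I(M))`. -/
noncomputable def multiplicityWrt {S : Type*} [CommRing S] (I : Ideal S) (M : Type*)
    [AddCommGroup M] [Module S M] : ℤ :=
  hilbertMultiplicity (grHilbert I M)

/-- The `n`-th term `Hᵢ(n) / (n + w)^z` of the higher Zeta-Barnes type function. -/
noncomputable def zetaBarnesTerm (H : ℕ → ℕ) (i : ℕ) (z : ℂ) (w : ℝ) (n : ℕ) : ℂ :=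
  (iteratedHilbert H i n : ℂ) / ((n : ℂ) + (w : ℂ)) ^ z

/-- The higher Zeta-Barnes type function `ζⁱ(z, w) = ∑_{n ≥ 0} Hᵢ(n) / (n + w)^z`. -/
noncomputable def zetaBarnes (H : ℕ → ℕ) (i : ℕ) (z : ℂ) (w : ℝ) : ℂ :=
  ∑' n : ℕ, zetaBarnesTerm H i z w n

/-- `Z` is the meromorphic function `ζⁱ(z) = lim_{w ↘ 0} (ζⁱ(z, w) - H(0) w^{-z})` on `ℂ`:
it is meromorphic on the whole plane and is given by this limit, all the series involved being
convergent, on some right half-plane. Thus `Z` is unique up to its values on a discrete set. -/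
structure IsHigherZeta (H : ℕ → ℕ) (i : ℕ) (Z : ℂ → ℂ) : Prop where
  meromorphic : Meromorphic Z
  eq_lim : ∃ σ : ℝ, ∀ z : ℂ, σ < z.re →
    (∀ w : ℝ, 0 < w → Summable (zetaBarnesTerm H i z w)) ∧
    Filter.Tendsto (fun w : ℝ => zetaBarnes H i z w - (H 0 : ℂ) * (w : ℂ) ^ (-z))
      (𝓝[>] 0) (𝓝 (Z z))

/-- The residue of `f` at `a`: the value of `(2πi)⁻¹ ∮ f` over all small circles about `a`. -/
noncomputable def complexResidue (f : ℂ → ℂ) (a : ℂ) : ℂ :=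
  Filter.limUnder (𝓝[>] (0 : ℝ)) fun r : ℝ =>
    (2 * (Real.pi : ℂ) * Complex.I)⁻¹ * ∮ z in C(a, r), f z

/-! ### Additivity of length for quotients -/

section Length

variable {R M N : Type*} [CommRing R] [AddCommGroup M] [Module R M] [AddCommGroup N] [Module R N]

/-! By telescoping, H₁(n) is the length of M/Iⁿ⁺¹M. Once the Hilbert series is h(t)/(1-t)^d, the
series of H₁ is h(t)/(1-t)^(d+1), so H₁(n) = P(n) for large n, where P has degree at most d and
tᵈ-coefficient h(1)/d! (`exists_hilbertSamuel_polynomial`). Hence ∑ H₁(n) n⁻ᶻ = ∑ⱼ Pⱼ ζ(z-j) plus a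
finite Dirichlet sum. Only j = d has a pole at z = d+1, and its residue there is h(1)/d!. The limit
w ↘ 0 is dominated convergence (`isHigherZeta_of_hasSum`), and the identity theorem carries the
residue to every admissible continuation.

It remains to prove rationality and d = m. Rationality is `hilbertSerre_filtration`, which replaces
graded modules by pairs of filtrations of M, so that only lengths of quotients of M occur. The
equality d = m is read off from the growth order of H₁. For d ≤ m, compare I with an ideal generated
by m parameters and the annihilator. For m ≤ d, embed S/q in M for a minimal prime q of the
annihilator; growth passes to S/q by Artin–Rees and drops by one at each step of a chain of primes
(`coheight_le_of_hilbertSamuelGrowth`). -/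

theorem length_quotient_eq_add_of_range (f : N →ₗ[R] M) (U : Submodule R M) :
    Module.length R (M ⧸ U) =
      Module.length R (N ⧸ U.comap f) + Module.length R (M ⧸ (U ⊔ LinearMap.range f)) := by
  refine Module.length_eq_add_of_exact (Submodule.mapQ (U.comap f) U f le_rfl)
    (Submodule.factor le_sup_left) ?_ (Submodule.factor_surjective _) ?_
  · rw [← LinearMap.ker_eq_bot, Submodule.ker_mapQ]
    simp
  · rw [LinearMap.exact_iff, Submodule.factor, Submodule.ker_mapQ, Submodule.comap_id,
      Submodule.range_mapQ, Submodule.map_sup]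
    simp

theorem length_quotient_eq_add_of_le {A B : Submodule R M} (h : B ≤ A) :
    Module.length R (M ⧸ B) = Module.length R (A ⧸ B.submoduleOf A) + Module.length R (M ⧸ A) := by
  have := length_quotient_eq_add_of_range A.subtype B
  rwa [Submodule.range_subtype, sup_eq_right.2 h] at this

theorem length_quotient_antitone {A B : Submodule R M} (h : B ≤ A) :
    Module.length R (M ⧸ A) ≤ Module.length R (M ⧸ B) := by
  rw [length_quotient_eq_add_of_le h]
  exact le_add_self

theorem length_quotient_ne_top_of_le {A B : Submodule R M} (h : B ≤ A)
    (hB : Module.length R (M ⧸ B) ≠ ⊤) : Module.length R (M ⧸ A) ≠ ⊤ :=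
  ne_top_of_le_ne_top hB (length_quotient_antitone h)

/-- The length of `M ⧸ A` as an integer (`0` if it is infinite). -/
noncomputable def colength (A : Submodule R M) : ℤ := ((Module.length R (M ⧸ A)).toNat : ℤ)

/-- Multiplication by `x` from `V ⧸ (V ∩ x⁻¹U)` to `M ⧸ U`, expressed in colengths. -/
theorem colength_add_colength (x : R) (V U : Submodule R M)
    (hV : Module.length R (M ⧸ (V ⊓ U.comap (LinearMap.lsmul R M x))) ≠ ⊤)
    (hU : Module.length R (M ⧸ U) ≠ ⊤) :
    colength (V ⊓ U.comap (LinearMap.lsmul R M x)) +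
        colength (U ⊔ V.map (LinearMap.lsmul R M x)) = colength V + colength U := by
  have h1 := length_quotient_eq_add_of_le (A := V)
    (inf_le_left : V ⊓ U.comap (LinearMap.lsmul R M x) ≤ V)
  have h2 := length_quotient_eq_add_of_range ((LinearMap.lsmul R M x).comp V.subtype) U
  rw [LinearMap.range_comp, Submodule.range_subtype] at h2
  have h3 : U.comap ((LinearMap.lsmul R M x).comp V.subtype) =
      (V ⊓ U.comap (LinearMap.lsmul R M x)).submoduleOf V := by
    ext v
    simp [Submodule.submoduleOf]
  rw [h3] at h2
  have h4 : Module.length R (M ⧸ V) ≠ ⊤ := length_quotient_ne_top_of_le inf_le_left hV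
  have h5 : Module.length R (M ⧸ (U ⊔ V.map (LinearMap.lsmul R M x))) ≠ ⊤ :=
    length_quotient_ne_top_of_le le_sup_left hU
  have h6 : Module.length R (V ⧸ (V ⊓ U.comap (LinearMap.lsmul R M x)).submoduleOf V) ≠ ⊤ := by
    intro h
    rw [h, top_add] at h1
    exact hV h1
  unfold colength
  lift Module.length R (M ⧸ V) to ℕ using h4 with a
  lift Module.length R (M ⧸ (U ⊔ V.map (LinearMap.lsmul R M x))) to ℕ using h5 with b
  lift Module.length R (V ⧸ (V ⊓ U.comap (LinearMap.lsmul R M x)).submoduleOf V) to ℕ using h6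
    with c
  rw [h1, h2]
  norm_cast
  simp only [ENat.toNat_natCast]
  ring

end Length

/-! ### Hilbert–Serre theorem for pairs of filtrations -/

section HilbertSerre

open Ideal

variable {R M : Type*} [CommRing R] [AddCommGroup M] [Module R M]

/-- The elements of `V n` which multiplication by `x` sends into `U (n + 1)`. -/
def Ideal.Filtration.mulKer {I : Ideal R} (V U : I.Filtration M) (x : R) : I.Filtration M where
  N n := V.N n ⊓ (U.N (n + 1)).comap (LinearMap.lsmul R M x)
  mono n := inf_le_inf (V.mono n) (Submodule.comap_mono (U.mono _))
  smul_le n := by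
    refine le_inf ((smul_mono_right _ inf_le_left).trans (V.smul_le n)) ?_
    rw [← Submodule.map_le_iff_le_comap, Submodule.map_smul'']
    refine (smul_mono_right _ ?_).trans (U.smul_le (n + 1))
    exact (Submodule.map_mono inf_le_right).trans (Submodule.map_comap_le _ _)

/-- The sequence `U (n + 1) + x V n`, starting with `U 0`. -/
def Ideal.Filtration.addMulRange {I : Ideal R} (V U : I.Filtration M) (x : R)
    (hx : ∀ n, (V.N n).map (LinearMap.lsmul R M x) ≤ U.N n) : I.Filtration M where
  N
    | 0 => U.N 0
    | n + 1 => U.N (n + 1) ⊔ (V.N n).map (LinearMap.lsmul R M x)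
  mono
    | 0 => sup_le (U.mono 0) (hx 0)
    | n + 1 => sup_le_sup (U.mono _) (Submodule.map_mono (V.mono _))
  smul_le
    | 0 => (U.smul_le 0).trans le_sup_left
    | n + 1 => by
      change I • (U.N (n + 1) ⊔ (V.N n).map (LinearMap.lsmul R M x)) ≤
        U.N (n + 1 + 1) ⊔ (V.N (n + 1)).map (LinearMap.lsmul R M x)
      rw [Submodule.smul_sup, ← Submodule.map_smul'']
      exact sup_le_sup (U.smul_le _) (Submodule.map_mono (V.smul_le _))

theorem map_lsmul_le_of_mem {I : Ideal R} {x : R} (hx : x ∈ I) (N : Submodule R M) :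
    N.map (LinearMap.lsmul R M x) ≤ I • N := by
  rintro _ ⟨y, hy, rfl⟩
  exact Submodule.smul_mem_smul hx hy

/-- **Hilbert–Serre theorem** for the graded module `⨁ V n ⧸ U n` attached to two filtrations. -/
theorem hilbertSerre_filtration [IsNoetherianRing R] [Module.Finite R M] (I : Ideal R)
    (L : List R) : ∀ (J : Ideal R) (_ : I = Ideal.ofList L ⊔ J) (V U : I.Filtration M)
      (_ : V.Stable) (_ : ∀ n, U.N n ≤ V.N n) (_ : ∀ n, I • V.N n ≤ U.N n)
      (_ : ∀ n, J • V.N n ≤ U.N (n + 1)) (_ : ∀ n, Module.length R (M ⧸ U.N n) ≠ ⊤),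
      ∃ p : Polynomial ℤ,
        PowerSeries.mk (fun n => colength (U.N n) - colength (V.N n)) *
          (1 - PowerSeries.X) ^ L.length = (p : PowerSeries ℤ) := by
  induction L with
  | nil =>
    intro J hJ V U hV hUV _ hJU _
    obtain ⟨n₀, hn₀⟩ := hV
    -- With no generators left, I = J. Stability gives V (n+1) = I • V n ≤ U (n+1) for large n, so
    -- the series is a polynomial.
    have hzero : ∀ n, n₀ + 1 ≤ n → colength (U.N n) - colength (V.N n) = 0 := by
      intro n hn
      obtain ⟨k, rfl⟩ : ∃ k, n = k + 1 := ⟨n - 1, by omega⟩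
      have : V.N (k + 1) = U.N (k + 1) := by
        refine le_antisymm ?_ (hUV _)
        rw [← hn₀ k (by omega)]
        have : I = J := by simpa using hJ
        exact this ▸ hJU k
      rw [this, sub_self]
    refine ⟨PowerSeries.trunc (n₀ + 1)
      (PowerSeries.mk fun n => colength (U.N n) - colength (V.N n)), ?_⟩
    ext n
    rw [List.length_nil, pow_zero, mul_one, Polynomial.coeff_coe, PowerSeries.coeff_trunc]
    split_ifs with h
    · rfl
    · rw [PowerSeries.coeff_mk, hzero n (by omega)]
  | cons x L ih =>
    intro J hJ V U hV hUV hIU hJU hfin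
    have hxI : x ∈ I := by
      rw [hJ, Ideal.ofList_cons]
      exact Ideal.mem_sup_left (Ideal.mem_sup_left (Ideal.mem_span_singleton_self x))
    have hx : ∀ n, (V.N n).map (LinearMap.lsmul R M x) ≤ U.N n := fun n =>
      (map_lsmul_le_of_mem hxI _).trans (hIU n)
    have hJ' : I = Ideal.ofList L ⊔ (Ideal.span {x} ⊔ J) := by
      rw [hJ, Ideal.ofList_cons, sup_comm (Ideal.span {x}), sup_assoc]
    have hspan : ∀ N : Submodule R M,
        Ideal.span {x} • N = N.map (LinearMap.lsmul R M x) := fun N => by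
      rw [Submodule.ideal_span_singleton_smul]; rfl
    -- Multiplication by x from V n / U n to V (n+1) / U (n+1) has kernel K n / U n and cokernel V
    -- (n+1) / C (n+1). It kills both, so x can be moved from the list into J. Stability of K is
    -- where Artin–Rees enters.
    let K := V.mulKer U x
    let C := V.addMulRange U x hx
    have hUK : ∀ n, U.N n ≤ K.N n := fun n => by
      refine le_inf (hUV n) ?_
      rw [← Submodule.map_le_iff_le_comap]
      exact (map_lsmul_le_of_mem hxI _).trans (U.smul_le n)
    have hUC : ∀ n, U.N n ≤ C.N n
      | 0 => le_rfl
      | n + 1 => le_sup_left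
    obtain ⟨p, hp⟩ := ih (Ideal.span {x} ⊔ J) hJ' K U
      (hV.of_le (F' := K) fun n => inf_le_left) hUK
      (fun n => (smul_mono_right _ inf_le_left).trans (hIU n))
      (fun n => by
        rw [Submodule.sup_smul]
        refine sup_le ?_ ((smul_mono_right _ inf_le_left).trans (hJU n))
        rw [hspan, Submodule.map_le_iff_le_comap]
        exact inf_le_right) hfin
    obtain ⟨q, hq⟩ := ih (Ideal.span {x} ⊔ J) hJ' V C hV
      (fun n => match n with
        | 0 => hUV 0
        | n + 1 => sup_le (hUV _) ((map_lsmul_le_of_mem hxI _).trans (V.smul_le n)))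
      (fun n => (hIU n).trans (hUC n))
      (fun n => by
        rw [Submodule.sup_smul, hspan]
        exact sup_le le_sup_right ((hJU n).trans (hUC _)))
      (fun n => length_quotient_ne_top_of_le (hUC n) (hfin n))
    have key : ∀ n, colength (K.N n) + colength (C.N (n + 1)) =
        colength (V.N n) + colength (U.N (n + 1)) := fun n =>
      colength_add_colength x (V.N n) (U.N (n + 1))
        (length_quotient_ne_top_of_le (hUK n) (hfin n)) (hfin _)
    have hseries : PowerSeries.mk (fun n => colength (U.N n) - colength (V.N n)) *
          (1 - PowerSeries.X) =
        PowerSeries.mk (fun n => colength (C.N n) - colength (V.N n)) -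
          PowerSeries.X * PowerSeries.mk (fun n => colength (U.N n) - colength (K.N n)) := by
      ext n
      rw [mul_sub, mul_one, map_sub, map_sub]
      cases n with
      | zero =>
        simp only [PowerSeries.coeff_mk, PowerSeries.coeff_zero_mul_X,
          PowerSeries.coeff_zero_X_mul]
        rfl
      | succ n =>
        simp only [PowerSeries.coeff_mk, PowerSeries.coeff_succ_mul_X,
          PowerSeries.coeff_succ_X_mul]
        linarith [key n]
    refine ⟨q - Polynomial.X * p, ?_⟩
    rw [List.length_cons, pow_succ', ← mul_assoc, hseries, sub_mul, hq, mul_assoc, hp,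
      Polynomial.coe_sub, Polynomial.coe_mul, Polynomial.coe_X]

end HilbertSerre

/-! ### From the Hilbert series to polynomial growth -/

section HilbertSeries

open Filter

theorem iteratedHilbert_one (H : ℕ → ℕ) (n : ℕ) :
    iteratedHilbert H 1 n = ∑ j ∈ Finset.range (n + 1), H j := rfl

theorem mk_iteratedHilbert_one_mul (F : Type*) [Field F] (H : ℕ → ℕ) :
    PowerSeries.mk (fun n => (iteratedHilbert H 1 n : F)) * (1 - PowerSeries.X) =
      PowerSeries.mk (fun n => (H n : F)) := by
  ext n
  rw [mul_sub, mul_one, map_sub]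
  cases n with
  | zero => simp [iteratedHilbert_one]
  | succ n =>
    simp only [PowerSeries.coeff_mk, PowerSeries.coeff_succ_mul_X, iteratedHilbert_one]
    rw [Finset.sum_range_succ _ (n + 1)]
    push_cast
    ring

/-- The Hilbert–Samuel function is eventually a polynomial. -/
theorem exists_hilbertSamuel_polynomial (F : Type*) [Field F] [CharZero F] {H : ℕ → ℕ} {d : ℕ}
    {h : Polynomial ℤ}
    (hH : PowerSeries.mk (fun n => (H n : ℤ)) * (1 - PowerSeries.X) ^ d = (h : PowerSeries ℤ)) :
    ∃ P : Polynomial F, P.natDegree ≤ d ∧ P.coeff d = ((h.eval 1 : ℤ) : F) / (d.factorial : F) ∧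
      ∃ N, ∀ n, N ≤ n → (iteratedHilbert H 1 n : F) = P.eval (n : F) := by
  set p : Polynomial F := h.map (Int.castRingHom F) with hp
  have hF : PowerSeries.mk (fun n => (H n : F)) * (1 - PowerSeries.X) ^ d = (p : PowerSeries F) := by
    have := congrArg (PowerSeries.map (Int.castRingHom F)) hH
    rw [map_mul, map_pow, map_sub, map_one, PowerSeries.map_X] at this
    rw [hp, Polynomial.polynomial_map_coe, ← this]
    congr 1
    ext n
    simp
  have hmk : PowerSeries.mk (fun n => (iteratedHilbert H 1 n : F)) =
      (p : PowerSeries F) * PowerSeries.invOneSubPow F (d + 1) := by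
    rw [← hF, ← mk_iteratedHilbert_one_mul F H, mul_assoc, mul_assoc, ← mul_assoc (1 - PowerSeries.X),
      ← pow_succ', ← PowerSeries.invOneSubPow_inv_eq_one_sub_pow, Units.inv_val, mul_one]
  -- Summation adds one factor to the denominator, hence d + 1. Each monomial of p contributes its
  -- coefficient times a polynomial with tᵈ-coefficient 1/d!, and these coefficients sum to h(1).
  refine ⟨Polynomial.hilbertPoly p (d + 1), ?_, ?_, p.natDegree + 1, fun n hn => ?_⟩
  · rw [Polynomial.hilbertPoly_succ]
    refine Polynomial.natDegree_sum_le_of_forall_le _ _ fun i _ => ?_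
    exact (Polynomial.natDegree_smul_le _ _).trans (Polynomial.natDegree_preHilbertPoly F d i).le
  · have h1 : ((h.eval 1 : ℤ) : F) = p.eval 1 := by
      rw [hp, Polynomial.eval_one_map]; simp
    rw [Polynomial.hilbertPoly_succ, h1, Polynomial.eval_eq_sum, Polynomial.sum_def]
    simp only [Polynomial.finsetSum_coeff, Polynomial.coeff_smul, smul_eq_mul,
      Polynomial.coeff_preHilbertPoly_self, one_pow, mul_one, ← Finset.sum_mul, div_eq_mul_inv]
  · rw [← Polynomial.coeff_mul_invOneSubPow_eq_hilbertPoly_eval (d + 1) (by omega), ← hmk,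
      PowerSeries.coeff_mk]

theorem tendsto_iteratedHilbert_div {H : ℕ → ℕ} {d : ℕ} {h : Polynomial ℤ}
    (hH : PowerSeries.mk (fun n => (H n : ℤ)) * (1 - PowerSeries.X) ^ d = (h : PowerSeries ℤ)) :
    Tendsto (fun n : ℕ => (iteratedHilbert H 1 n : ℝ) / (n : ℝ) ^ d) atTop
      (𝓝 (((h.eval 1 : ℤ) : ℝ) / (d.factorial : ℝ))) := by
  obtain ⟨P, hdeg, hcoeff, N, hN⟩ := exists_hilbertSamuel_polynomial ℝ hH
  have key : Tendsto (fun x : ℝ => P.eval x / (Polynomial.X ^ d : Polynomial ℝ).eval x) atTop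
      (𝓝 (P.coeff d)) := by
    rcases hdeg.lt_or_eq with hlt | heq
    · rw [Polynomial.coeff_eq_zero_of_natDegree_lt hlt]
      refine Polynomial.div_tendsto_atTop_zero_of_degree_lt _ _ ?_
      rw [Polynomial.degree_X_pow]
      exact Polynomial.degree_le_natDegree.trans_lt (by exact_mod_cast hlt)
    · by_cases hP : P = 0
      · simp [hP]
      have := Polynomial.div_tendsto_atTop_leadingCoeff_div_of_degree_eq P (Polynomial.X ^ d) (by
        rw [Polynomial.degree_X_pow, Polynomial.degree_eq_natDegree hP, heq])
      rwa [Polynomial.leadingCoeff_X_pow, div_one, Polynomial.leadingCoeff, heq] at this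
  rw [hcoeff] at key
  refine (key.comp tendsto_natCast_atTop_atTop).congr' ?_
  filter_upwards [eventually_ge_atTop N] with n hn
  simp [hN n hn]

theorem exists_iteratedHilbert_le {H : ℕ → ℕ} {d : ℕ} {h : Polynomial ℤ}
    (hH : PowerSeries.mk (fun n => (H n : ℤ)) * (1 - PowerSeries.X) ^ d = (h : PowerSeries ℤ)) :
    ∃ C : ℕ, ∀ n, iteratedHilbert H 1 n ≤ C * (n + 1) ^ d := by
  obtain ⟨B, hB⟩ := (tendsto_iteratedHilbert_div hH).bddAbove_range
  obtain ⟨C, hC⟩ := exists_nat_ge B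
  -- The summand `H 0` covers n = 0, where the bounded quotient has denominator 0 ^ d and may carry
  -- no information.
  refine ⟨C + H 0, fun n => ?_⟩
  rcases n.eq_zero_or_pos with rfl | hn
  · simp [iteratedHilbert_one]
  · have h1 : (iteratedHilbert H 1 n : ℝ) / (n : ℝ) ^ d ≤ C := (hB ⟨n, rfl⟩).trans hC
    rw [div_le_iff₀ (by positivity)] at h1
    have h2 : iteratedHilbert H 1 n ≤ C * n ^ d := by exact_mod_cast h1
    refine h2.trans (Nat.mul_le_mul (by omega) (Nat.pow_le_pow_left (by omega) d))

/-- If e < d, the bound would force H₁(n)/nᵈ → 0, while the limit is h(1)/d! ≠ 0. Thus d is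
determined by growth alone. -/
theorem le_of_iteratedHilbert_le {H : ℕ → ℕ} {d e C : ℕ} {h : Polynomial ℤ}
    (hH : IsHilbertNumerator H d h) (hC : ∀ n, iteratedHilbert H 1 n ≤ C * (n + 1) ^ e) :
    d ≤ e := by
  by_contra! hlt
  refine hH.2 ?_
  have h1 := tendsto_iteratedHilbert_div hH.1
  have h2 : Tendsto (fun n : ℕ => (iteratedHilbert H 1 n : ℝ) / (n : ℝ) ^ d) atTop (𝓝 0) := by
    have h3 : Tendsto (fun n : ℕ => (C * 2 ^ e : ℝ) / (n : ℝ)) atTop (𝓝 0) :=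
      tendsto_const_div_atTop_nhds_zero_nat _
    refine squeeze_zero' (Eventually.of_forall fun n => by positivity) ?_ h3
    filter_upwards [eventually_ge_atTop 1] with n hn
    have hn' : (1 : ℝ) ≤ n := by exact_mod_cast hn
    rw [div_le_div_iff₀ (by positivity) (by positivity)]
    have h4 : (iteratedHilbert H 1 n : ℝ) ≤ C * (n + 1) ^ e := by exact_mod_cast hC n
    calc (iteratedHilbert H 1 n : ℝ) * n ≤ C * (n + 1) ^ e * n := by gcongr
      _ ≤ C * (2 * n) ^ e * n := by gcongr; linarith
      _ = C * 2 ^ e * (n : ℝ) ^ (e + 1) := by ring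
      _ ≤ C * 2 ^ e * (n : ℝ) ^ d := mul_le_mul_of_nonneg_left (pow_le_pow_right₀ hn' hlt) (by positivity)
  have h5 := tendsto_nhds_unique h1 h2
  have h6 : (d.factorial : ℝ) ≠ 0 := by positivity
  rw [div_eq_zero_iff, or_iff_left h6] at h5
  exact_mod_cast h5

theorem IsHilbertNumerator.not_lt {H : ℕ → ℕ} {d e : ℕ} {h k : Polynomial ℤ}
    (hd : IsHilbertNumerator H d h) (he : IsHilbertNumerator H e k) : ¬ d < e := by
  intro hlt
  obtain ⟨C, hC⟩ := exists_iteratedHilbert_le hd.1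
  exact absurd (le_of_iteratedHilbert_le he hC) (by omega)

theorem IsHilbertNumerator.hilbertMultiplicity_eq {H : ℕ → ℕ} {d : ℕ} {h : Polynomial ℤ}
    (hd : IsHilbertNumerator H d h) : hilbertMultiplicity H = h.eval 1 := by
  have hex : ∃ p : ℕ × Polynomial ℤ, IsHilbertNumerator H p.1 p.2 := ⟨(d, h), hd⟩
  rw [hilbertMultiplicity, dif_pos hex]
  have he := hex.choose_spec
  have heq : hex.choose.1 = d := le_antisymm (Nat.le_of_not_lt (hd.not_lt he))
    (Nat.le_of_not_lt (he.not_lt hd))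
  have h1 := he.1
  rw [heq, hd.1] at h1
  rw [Polynomial.coe_injective ℤ h1]

/-- Factors 1 - t are cancelled while p(1) = 0. If none remain, p has the nonnegative coefficients
H(n), not all zero, so p(1) > 0. -/
theorem exists_isHilbertNumerator {H : ℕ → ℕ} (hH : ∃ n, H n ≠ 0) {r : ℕ} {p : Polynomial ℤ}
    (hp : PowerSeries.mk (fun n => (H n : ℤ)) * (1 - PowerSeries.X) ^ r = (p : PowerSeries ℤ)) :
    ∃ d h, IsHilbertNumerator H d h := by
  obtain ⟨n₀, hn₀⟩ := hH
  have hX : (1 - PowerSeries.X : PowerSeries ℤ) = ((1 - Polynomial.X : Polynomial ℤ) :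
      PowerSeries ℤ) := by simp
  have hne : (1 - PowerSeries.X : PowerSeries ℤ) ≠ 0 := fun h0 => by
    simpa using congrArg PowerSeries.constantCoeff h0
  induction r generalizing p with
  | zero =>
    rw [pow_zero, mul_one] at hp
    refine ⟨0, p, by rw [pow_zero, mul_one, hp], ?_⟩
    have hcoeff : ∀ n, p.coeff n = H n := fun n => by
      rw [← Polynomial.coeff_coe, ← hp, PowerSeries.coeff_mk]
    rw [Polynomial.eval_eq_sum, Polynomial.sum_def]
    simp only [one_pow, mul_one]
    refine (Finset.sum_pos (fun i hi => ?_) ⟨n₀, ?_⟩).ne'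
    · have := Polynomial.mem_support_iff.1 hi
      rw [hcoeff] at this ⊢
      positivity
    · rw [Polynomial.mem_support_iff, hcoeff]
      exact_mod_cast hn₀
  | succ r ih =>
    by_cases h1 : p.eval 1 = 0
    · obtain ⟨q, hq⟩ := Polynomial.dvd_iff_isRoot.2 h1
      refine ih (p := -q) (mul_right_cancel₀ hne ?_)
      rw [mul_assoc, ← pow_succ, hp, hq, hX, ← Polynomial.coe_mul]
      congr 1
      rw [map_one]
      ring
    · exact ⟨r + 1, p, hp, h1⟩

end HilbertSeries

/-! ### Finite length and the Hilbert function of gr_I(M) -/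

section FiniteLength

variable {S M : Type*} [CommRing S] [AddCommGroup M] [Module S M]

/-- The ring S/𝔪ᵏ is Noetherian local with nilpotent maximal ideal, hence Artinian, and the quotient
is a finite module over it. The case k = 0 is separate because that ring is then zero. -/
theorem length_quotient_pow_maximalIdeal_ne_top [IsLocalRing S] [IsNoetherianRing S]
    [Module.Finite S M] (k : ℕ) :
    Module.length S (M ⧸ (IsLocalRing.maximalIdeal S ^ k • (⊤ : Submodule S M))) ≠ ⊤ := by
  rcases subsingleton_or_nontrivial (S ⧸ IsLocalRing.maximalIdeal S ^ k) with hs | hn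
  · have h1 : IsLocalRing.maximalIdeal S ^ k = ⊤ := Ideal.Quotient.subsingleton_iff.1 hs
    rw [h1, Submodule.top_smul, Module.length_eq_zero]
    exact ENat.zero_ne_top
  · have := IsLocalRing.of_surjective' _
      (Ideal.Quotient.mk_surjective (I := IsLocalRing.maximalIdeal S ^ k))
    have hart : IsArtinianRing (S ⧸ IsLocalRing.maximalIdeal S ^ k) := by
      rw [isArtinianRing_iff_isNilpotent_maximalIdeal]
      refine ⟨k, ?_⟩
      have hle : IsLocalRing.maximalIdeal (S ⧸ IsLocalRing.maximalIdeal S ^ k) ≤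
          (IsLocalRing.maximalIdeal S).map (Ideal.Quotient.mk (IsLocalRing.maximalIdeal S ^ k)) := by
        rw [← Ideal.map_comap_of_surjective _ Ideal.Quotient.mk_surjective
          (IsLocalRing.maximalIdeal (S ⧸ IsLocalRing.maximalIdeal S ^ k))]
        exact Ideal.map_mono (IsLocalRing.le_maximalIdeal (Ideal.comap_ne_top _ Ideal.IsPrime.ne_top'))
      refine le_bot_iff.1 ((Ideal.pow_right_mono hle k).trans ?_)
      rw [← Ideal.map_pow, Ideal.map_quotient_self]
    have : IsArtinian S (M ⧸ (IsLocalRing.maximalIdeal S ^ k • (⊤ : Submodule S M))) :=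
      isArtinian_of_surjective_algebraMap (R := S ⧸ IsLocalRing.maximalIdeal S ^ k)
        Ideal.Quotient.mk_surjective
    exact Module.length_ne_top

theorem pow_smul_top_le_of_smul_top_le {I J : Ideal S}
    (h : J • (⊤ : Submodule S M) ≤ I • ⊤) (n : ℕ) :
    J ^ n • (⊤ : Submodule S M) ≤ I ^ n • ⊤ := by
  induction n with
  | zero => simp
  | succ n ih =>
    calc J ^ (n + 1) • (⊤ : Submodule S M) = J • J ^ n • ⊤ := by rw [pow_succ', mul_smul]
      _ ≤ J • I ^ n • ⊤ := smul_mono_right _ ih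
      _ = I ^ n • J • ⊤ := smul_comm _ _ _
      _ ≤ I ^ n • I • ⊤ := smul_mono_right _ h
      _ = I ^ (n + 1) • ⊤ := by rw [pow_succ, mul_smul]

theorem length_quotient_pow_ne_top [IsLocalRing S] [IsNoetherianRing S] [Module.Finite S M]
    {I : Ideal S} {k : ℕ}
    (h : IsLocalRing.maximalIdeal S ^ k • (⊤ : Submodule S M) ≤ I • ⊤) (n : ℕ) :
    Module.length S (M ⧸ (I ^ n • (⊤ : Submodule S M))) ≠ ⊤ := by
  refine length_quotient_ne_top_of_le ?_ (length_quotient_pow_maximalIdeal_ne_top (k * n))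
  rw [pow_mul]
  exact pow_smul_top_le_of_smul_top_le h n

variable {I : Ideal S}

theorem pow_succ_smul_top_le (n : ℕ) :
    I ^ (n + 1) • (⊤ : Submodule S M) ≤ I ^ n • ⊤ :=
  Submodule.smul_mono_left (Ideal.pow_le_pow_right n.le_succ)

theorem length_grPiece_ne_top
    (hfin : ∀ n, Module.length S (M ⧸ (I ^ n • (⊤ : Submodule S M))) ≠ ⊤) (n : ℕ) :
    Module.length S (GrPiece I M n) ≠ ⊤ := fun h => by
  have := length_quotient_eq_add_of_le (pow_succ_smul_top_le (M := M) (I := I) n)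
  rw [h, top_add] at this
  exact hfin _ this

theorem grHilbert_eq_colength_sub
    (hfin : ∀ n, Module.length S (M ⧸ (I ^ n • (⊤ : Submodule S M))) ≠ ⊤) (n : ℕ) :
    (grHilbert I M n : ℤ) =
      colength (I ^ (n + 1) • (⊤ : Submodule S M)) - colength (I ^ n • (⊤ : Submodule S M)) := by
  have h := length_quotient_eq_add_of_le (pow_succ_smul_top_le (M := M) (I := I) n)
  unfold grHilbert colength
  rw [h, ENat.toNat_add (length_grPiece_ne_top hfin n) (hfin n)]
  push_cast
  ring

theorem iteratedHilbert_grHilbert_eq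
    (hfin : ∀ n, Module.length S (M ⧸ (I ^ n • (⊤ : Submodule S M))) ≠ ⊤) (n : ℕ) :
    (iteratedHilbert (grHilbert I M) 1 n : ℕ∞) =
      Module.length S (M ⧸ (I ^ (n + 1) • (⊤ : Submodule S M))) := by
  have h : (iteratedHilbert (grHilbert I M) 1 n : ℤ) =
      colength (I ^ (n + 1) • (⊤ : Submodule S M)) := by
    rw [iteratedHilbert_one, Nat.cast_sum]
    simp only [grHilbert_eq_colength_sub hfin]
    rw [Finset.sum_range_sub (fun n => colength (I ^ n • (⊤ : Submodule S M)))]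
    simp [colength]
  unfold colength at h
  rw [Nat.cast_inj.1 h, ENat.natCast_toNat (hfin _)]

/-- **Hilbert–Serre theorem** for the associated graded module. -/
theorem hilbertSerre_grHilbert [IsNoetherianRing S] [Module.Finite S M] (L : List S) (J : Ideal S)
    (hI : I = Ideal.ofList L ⊔ J) (hJ : J • (⊤ : Submodule S M) = ⊥)
    (hfin : ∀ n, Module.length S (M ⧸ (I ^ n • (⊤ : Submodule S M))) ≠ ⊤) :
    ∃ p : Polynomial ℤ, PowerSeries.mk (fun n => (grHilbert I M n : ℤ)) *
      (1 - PowerSeries.X) ^ L.length = (p : PowerSeries ℤ) := by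
  simp only [grHilbert_eq_colength_sub hfin]
  let U : I.Filtration M :=
    { N := fun n => I ^ (n + 1) • ⊤
      mono := fun n => pow_succ_smul_top_le _
      smul_le := fun n => by rw [← mul_smul, ← pow_succ'] }
  refine hilbertSerre_filtration I L J hI (I.stableFiltration ⊤) U
    (I.stableFiltration_stable ⊤) (fun n => pow_succ_smul_top_le n) (fun n => ?_) (fun n => ?_)
    (fun n => hfin _)
  · change I • I ^ n • (⊤ : Submodule S M) ≤ I ^ (n + 1) • ⊤
    rw [← mul_smul, ← pow_succ']
  · exact (smul_mono_right _ le_top).trans (hJ ▸ bot_le)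

end FiniteLength

/-! ### Growth of the Hilbert–Samuel function bounds the dimension -/

section Growth

variable {S : Type*} [CommRing S]

/-- The Hilbert–Samuel function of `M` with respect to `I` is `O(n ^ d)`. -/
def HilbertSamuelGrowth (I : Ideal S) (M : Type*) [AddCommGroup M] [Module S M] (d : ℕ) : Prop :=
  ∃ C : ℕ, ∀ n, Module.length S (M ⧸ (I ^ n • (⊤ : Submodule S M))) ≤ (C * (n + 1) ^ d : ℕ)

variable {I : Ideal S} {M N P : Type*} [AddCommGroup M] [Module S M] [AddCommGroup N] [Module S N]
  [AddCommGroup P] [Module S P] {d : ℕ}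

theorem length_quotient_le_of_surjective (f : M →ₗ[S] N) (hf : Function.Surjective f)
    {A : Submodule S M} {B : Submodule S N} (h : A.map f ≤ B) :
    Module.length S (N ⧸ B) ≤ Module.length S (M ⧸ A) := by
  refine Module.length_le_of_surjective (Submodule.mapQ A B f (Submodule.map_le_iff_le_comap.1 h)) ?_
  intro y
  obtain ⟨y, rfl⟩ := Submodule.mkQ_surjective _ y
  obtain ⟨x, rfl⟩ := hf y
  exact ⟨Submodule.Quotient.mk x, rfl⟩

theorem HilbertSamuelGrowth.of_surjective (h : HilbertSamuelGrowth I M d) (f : M →ₗ[S] N)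
    (hf : Function.Surjective f) : HilbertSamuelGrowth I N d := by
  obtain ⟨C, hC⟩ := h
  refine ⟨C, fun n => (length_quotient_le_of_surjective f hf ?_).trans (hC n)⟩
  rw [Submodule.map_smul'']
  exact smul_mono_right _ le_top

/-- The **Artin–Rees lemma** for an injective linear map. -/
theorem exists_comap_pow_smul_le [IsNoetherianRing S] [Module.Finite S M] (I : Ideal S)
    (f : N →ₗ[S] M) (hf : Function.Injective f) :
    ∃ k, ∀ n, (I ^ (n + k) • (⊤ : Submodule S M)).comap f ≤ I ^ n • ⊤ := by
  obtain ⟨k, hk⟩ := I.exists_pow_inf_eq_pow_smul (LinearMap.range f)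
  refine ⟨k, fun n => ?_⟩
  have h1 : (I ^ (n + k) • (⊤ : Submodule S M)) ⊓ LinearMap.range f ≤
      (I ^ n • (⊤ : Submodule S N)).map f := by
    rw [hk _ (Nat.le_add_left _ _), Nat.add_sub_cancel, Submodule.map_smul'', Submodule.map_top]
    exact smul_mono_right _ inf_le_right
  intro x hx
  obtain ⟨y, hy, hxy⟩ := h1 ⟨hx, x, rfl⟩
  rwa [← hf hxy]

theorem HilbertSamuelGrowth.of_injective [IsNoetherianRing S] [Module.Finite S M]
    (h : HilbertSamuelGrowth I M d) (f : N →ₗ[S] M) (hf : Function.Injective f) :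
    HilbertSamuelGrowth I N d := by
  obtain ⟨C, hC⟩ := h
  obtain ⟨k, hk⟩ := exists_comap_pow_smul_le I f hf
  refine ⟨C * (k + 1) ^ d, fun n => ?_⟩
  calc Module.length S (N ⧸ (I ^ n • (⊤ : Submodule S N)))
      ≤ Module.length S (N ⧸ (I ^ (n + k) • (⊤ : Submodule S M)).comap f) :=
        length_quotient_antitone (hk n)
    _ ≤ Module.length S (M ⧸ (I ^ (n + k) • (⊤ : Submodule S M))) := by
        rw [length_quotient_eq_add_of_range f]
        exact le_self_add
    _ ≤ (C * (n + k + 1) ^ d : ℕ) := hC _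
    _ ≤ (C * (k + 1) ^ d * (n + 1) ^ d : ℕ) := by
        rw [mul_assoc, ← mul_pow]
        exact_mod_cast Nat.mul_le_mul_left _ (Nat.pow_le_pow_left (by nlinarith) d)

/-- Dividing by the image of an injective endomorphism lowers the growth by one. -/
theorem HilbertSamuelGrowth.exists_mul_length_le [IsNoetherianRing S] [Module.Finite S N]
    (h : HilbertSamuelGrowth I N d) (f : N →ₗ[S] N) (hf : Function.Injective f) (g : N →ₗ[S] P)
    (hg : Function.Surjective g) (hgf : g.comp f = 0) :
    ∃ C : ℕ, ∀ n : ℕ, ((n + 1 : ℕ) : ℕ∞) * Module.length S (P ⧸ (I ^ n • (⊤ : Submodule S P))) ≤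
      (C * (n + 1) ^ d : ℕ) := by
  obtain ⟨C, hC⟩ := h
  obtain ⟨k, hk⟩ := exists_comap_pow_smul_le I f hf
  -- Split N/Iⁿ⁺ᵏN along f: the image part has length at least that of N/IⁿN by Artin–Rees, and the
  -- cokernel surjects onto P/Iⁿ⁺ᵏP because g ∘ f = 0.
  have hstep : ∀ n, Module.length S (P ⧸ (I ^ (n + k) • (⊤ : Submodule S P))) +
      Module.length S (N ⧸ (I ^ n • (⊤ : Submodule S N))) ≤
        Module.length S (N ⧸ (I ^ (n + k) • (⊤ : Submodule S N))) := fun n => by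
    rw [length_quotient_eq_add_of_range f (I ^ (n + k) • (⊤ : Submodule S N)), add_comm]
    refine add_le_add (length_quotient_antitone (hk n))
      (length_quotient_le_of_surjective g hg ?_)
    rw [Submodule.map_sup, Submodule.map_smul'', ← LinearMap.range_comp, hgf, LinearMap.range_zero,
      sup_bot_eq]
    exact smul_mono_right _ le_top
  have hmono : ∀ {a b : ℕ}, a ≤ b → Module.length S (P ⧸ (I ^ a • (⊤ : Submodule S P))) ≤
      Module.length S (P ⧸ (I ^ b • (⊤ : Submodule S P))) := fun hab =>
    length_quotient_antitone (Submodule.smul_mono_left (Ideal.pow_le_pow_right hab))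
  have hiter : ∀ n j : ℕ, (j : ℕ∞) * Module.length S (P ⧸ (I ^ n • (⊤ : Submodule S P))) ≤
      Module.length S (N ⧸ (I ^ (n + k * j) • (⊤ : Submodule S N))) := by
    intro n j
    induction j with
    | zero => simp
    | succ j ih =>
      calc ((j + 1 : ℕ) : ℕ∞) * Module.length S (P ⧸ (I ^ n • (⊤ : Submodule S P)))
          = Module.length S (P ⧸ (I ^ n • (⊤ : Submodule S P))) +
            j * Module.length S (P ⧸ (I ^ n • (⊤ : Submodule S P))) := by
            push_cast; ring
        _ ≤ _ := add_le_add (hmono (by omega : n ≤ n + k * j + k)) ih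
        _ ≤ _ := hstep (n + k * j)
        _ = _ := by rw [mul_add, mul_one, ← add_assoc]
  -- Taking j = n + 1 steps of size k gives n + k(n+1) + 1 = (k+1)(n+1).
  refine ⟨C * (k + 1) ^ d, fun n => (hiter n (n + 1)).trans ((hC _).trans (le_of_eq ?_))⟩
  rw [mul_assoc, ← mul_pow]
  congr 3
  ring

theorem HilbertSamuelGrowth.pred_of_injective [IsNoetherianRing S] [Module.Finite S N]
    (h : HilbertSamuelGrowth I N (d + 1)) (f : N →ₗ[S] N) (hf : Function.Injective f)
    (g : N →ₗ[S] P) (hg : Function.Surjective g) (hgf : g.comp f = 0) :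
    HilbertSamuelGrowth I P d := by
  obtain ⟨C, hC⟩ := h.exists_mul_length_le f hf g hg hgf
  refine ⟨C, fun n => ?_⟩
  have h1 := hC n
  have h2 : Module.length S (P ⧸ (I ^ n • (⊤ : Submodule S P))) ≠ ⊤ := fun h0 => by
    rw [h0, ENat.mul_top (by simp)] at h1
    exact absurd (top_le_iff.1 h1) (ENat.natCast_ne_top _)
  lift Module.length S (P ⧸ (I ^ n • (⊤ : Submodule S P))) to ℕ using h2 with a
  norm_cast at h1 ⊢
  refine Nat.le_of_mul_le_mul_left (c := n + 1) ?_ n.succ_pos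
  rw [pow_succ] at h1
  linarith

theorem HilbertSamuelGrowth.subsingleton_of_injective [IsLocalRing S] [IsNoetherianRing S]
    [Module.Finite S N] (hI : I ≤ IsLocalRing.maximalIdeal S)
    (h : HilbertSamuelGrowth I N 0) (f : N →ₗ[S] N) (hf : Function.Injective f)
    (g : N →ₗ[S] P) (hg : Function.Surjective g) (hgf : g.comp f = 0) :
    Subsingleton P := by
  obtain ⟨C, hC⟩ := h.exists_mul_length_le f hf g hg hgf
  have : Module.Finite S P := Module.Finite.of_surjective g hg
  -- Here (C + 2) times a length is at most C, so the length is 0. The exponent C + 1 is positive,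
  -- which Nakayama's lemma needs below.
  have h1 := hC (C + 1)
  have h2 : Module.length S (P ⧸ (I ^ (C + 1) • (⊤ : Submodule S P))) = 0 := by
    by_contra h0
    have h3 := (mul_le_mul_right (Order.one_le_iff_ne_zero.2 h0)
      (((C + 1 + 1 : ℕ) : ℕ∞))).trans h1
    rw [mul_one, pow_zero, mul_one] at h3
    norm_cast at h3
    omega
  have h4 : I ^ (C + 1) • (⊤ : Submodule S P) = ⊤ :=
    Submodule.Quotient.subsingleton_iff.1 (Module.length_eq_zero_iff.1 h2)
  have h5 := Submodule.eq_bot_of_le_smul_of_le_jacobson_bot (I ^ (C + 1)) (⊤ : Submodule S P)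
    Module.Finite.fg_top h4.ge (by
      rw [IsLocalRing.jacobson_eq_maximalIdeal _ bot_ne_top]
      exact (Ideal.pow_le_self C.succ_ne_zero).trans hI)
  exact (Submodule.subsingleton_iff S).1 (subsingleton_of_bot_eq_top h5.symm)

/-- For p < q and x ∈ q \ p, multiplication by x is injective on the domain S/p and vanishes in S/q,
so passing from p to q lowers the growth exponent. At exponent 0 no such q can exist, since S/q
would be zero. -/
theorem coheight_le_of_hilbertSamuelGrowth [IsLocalRing S] [IsNoetherianRing S]
    (hI : I ≤ IsLocalRing.maximalIdeal S) (d : ℕ) : ∀ p : PrimeSpectrum S,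
      HilbertSamuelGrowth I (S ⧸ p.asIdeal) d → Order.coheight p ≤ d := by
  have aux : ∀ p q : PrimeSpectrum S, p < q → ∃ (f : (S ⧸ p.asIdeal) →ₗ[S] (S ⧸ p.asIdeal))
      (g : (S ⧸ p.asIdeal) →ₗ[S] (S ⧸ q.asIdeal)), Function.Injective f ∧
        Function.Surjective g ∧ g.comp f = 0 := by
    intro p q hpq
    obtain ⟨x, hxq, hxp⟩ := SetLike.exists_of_lt (PrimeSpectrum.asIdeal_lt_asIdeal p q |>.2 hpq)
    refine ⟨LinearMap.lsmul S _ x, Submodule.factor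
      ((PrimeSpectrum.asIdeal_le_asIdeal p q).2 hpq.le), ?_, Submodule.factor_surjective _, ?_⟩
    · rw [injective_iff_map_eq_zero]
      intro y hy
      obtain ⟨y, rfl⟩ := Ideal.Quotient.mk_surjective y
      have h1 : Ideal.Quotient.mk p.asIdeal (x * y) = 0 := hy
      rw [Ideal.Quotient.eq_zero_iff_mem] at h1 ⊢
      exact (p.isPrime.mem_or_mem h1).resolve_left hxp
    · ext
      exact Ideal.Quotient.eq_zero_iff_mem.2 (Ideal.mul_mem_right _ _ hxq)
  induction d with
  | zero =>
    intro p hp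
    rw [Order.coheight_le_coe_iff]
    intro q hpq
    obtain ⟨f, g, hf, hg, hgf⟩ := aux p q hpq
    have := hp.subsingleton_of_injective hI f hf g hg hgf
    exact absurd (Ideal.Quotient.subsingleton_iff.1 this) q.isPrime.ne_top
  | succ d ih =>
    intro p hp
    rw [Order.coheight_le_coe_iff]
    intro q hpq
    obtain ⟨f, g, hf, hg, hgf⟩ := aux p q hpq
    refine (ih q (hp.pred_of_injective f hf g hg hgf)).trans_lt ?_
    exact_mod_cast d.lt_succ_self

theorem supportDim_le_of_hilbertSamuelGrowth [IsLocalRing S] [IsNoetherianRing S]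
    [Module.Finite S M] (hI : I ≤ IsLocalRing.maximalIdeal S) (h : HilbertSamuelGrowth I M d) :
    Module.supportDim S M ≤ d := by
  refine iSup_le fun c => ?_
  have hmem := Module.mem_support_iff_of_finite.1 c.head.2
  obtain ⟨q, hq, hqp⟩ := Ideal.exists_minimalPrimes_le hmem
  have hass := Module.associatedPrimes.minimalPrimes_annihilator_subset_associatedPrimes S M hq
  obtain ⟨f, hf⟩ := ((isAssociatedPrime_iff_exists_injective_linearMap _ _).1 hass).2
  have h1 : Order.coheight c.head.1 ≤ d :=
    coheight_le_of_hilbertSamuelGrowth hI d c.head.1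
      ((h.of_injective f hf).of_surjective _ (Submodule.factor_surjective hqp))
  have h2 := Order.length_le_coheight (p := c.map Subtype.val fun _ _ hlt => hlt) (x := c.head.1)
    le_rfl
  exact_mod_cast h2.trans h1

end Growth

/-! ### Systems of parameters and the pole order -/

section Parameters

variable {S M : Type*} [CommRing S] [IsLocalRing S] [IsNoetherianRing S] [AddCommGroup M]
  [Module S M] [Module.Finite S M]

/-- Existence of a system of parameters of `M`. -/
theorem exists_system_of_parameters {m : ℕ} (hm : Module.supportDim S M = (m : WithBot ℕ∞)) :
    ∃ L : List S, L.length = m ∧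
      Ideal.ofList L ⊔ Module.annihilator S M ≤ IsLocalRing.maximalIdeal S ∧
      ∃ r, IsLocalRing.maximalIdeal S ^ r ≤ Ideal.ofList L ⊔ Module.annihilator S M := by
  classical
  set a := Module.annihilator S M with ha
  have hnt : Nontrivial M := by
    rw [← Module.supportDim_ne_bot_iff_nontrivial (R := S), hm]
    exact WithBot.coe_ne_bot
  have hann : a ≠ ⊤ := fun h => by
    exact not_subsingleton M (Module.annihilator_eq_top_iff.1 h)
  have : Nontrivial (S ⧸ a) := Ideal.Quotient.nontrivial_iff.2 hann
  have := IsLocalRing.of_surjective' _ (Ideal.Quotient.mk_surjective (I := a))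
  -- Converse of Krull's height theorem in S/a: the maximal ideal is minimal over an ideal generated
  -- by as many elements as its height, which is dim M.
  obtain ⟨s, hs, hcard⟩ :=
    (IsLocalRing.maximalIdeal (S ⧸ a)).exists_finset_card_eq_height_of_isNoetherianRing
  have hcard' : s.card = m := by
    rw [Module.supportDim_eq_ringKrullDim_quotient_annihilator,
      ← IsLocalRing.maximalIdeal_height_eq_ringKrullDim, ← hcard] at hm
    exact_mod_cast hm
  set L : List S := s.toList.map Quotient.out with hLdef
  have hL : (Ideal.ofList L).map (Ideal.Quotient.mk a) = Ideal.span (s : Set (S ⧸ a)) := by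
    rw [Ideal.map_ofList, hLdef, List.map_map]
    have : (Ideal.Quotient.mk a : S → S ⧸ a) ∘ Quotient.out = id := by
      ext x
      exact Quotient.out_eq x
    rw [this, List.map_id, Ideal.ofList]
    congr 1
    ext x
    simp
  have hcomap : (Ideal.span (s : Set (S ⧸ a))).comap (Ideal.Quotient.mk a) = Ideal.ofList L ⊔ a := by
    rw [← hL, Ideal.comap_map_of_surjective' _ Ideal.Quotient.mk_surjective, Ideal.mk_ker]
  refine ⟨L, by rw [hLdef, List.length_map, Finset.length_toList, hcard'], ?_, ?_⟩
  · rw [← hcomap]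
    refine IsLocalRing.le_maximalIdeal (Ideal.comap_ne_top _ fun h => ?_)
    exact Ideal.IsPrime.ne_top' (top_le_iff.1 (h ▸ hs.1.2))
  · refine Ideal.exists_pow_le_of_le_radical_of_fg ?_ (IsNoetherian.noetherian _)
    rw [← hcomap, ← Ideal.comap_radical, ← Ideal.map_le_iff_le_comap, Ideal.radical_eq_sInf]
    refine le_sInf fun q hq => ?_
    have hqm : IsLocalRing.maximalIdeal (S ⧸ a) ≤ q :=
      hs.2 ⟨hq.2, hq.1⟩ (IsLocalRing.le_maximalIdeal hq.2.ne_top)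
    refine le_trans ?_ hqm
    rw [Ideal.map_le_iff_le_comap]
    exact ((IsLocalRing.eq_maximalIdeal (Ideal.comap_isMaximal_of_surjective _
      Ideal.Quotient.mk_surjective)).ge)

/-- The Hilbert series of `gr_I(M)` is `h(t) / (1 - t) ^ dim M` with `h(1) ≠ 0`. -/
theorem exists_isHilbertNumerator_grHilbert {m : ℕ}
    (hm : Module.supportDim S M = (m : WithBot ℕ∞)) {I : Ideal S} (hI : I ≠ ⊤) {k : ℕ}
    (hk : IsLocalRing.maximalIdeal S ^ k • (⊤ : Submodule S M) ≤ I • ⊤) :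
    ∃ h : Polynomial ℤ, IsHilbertNumerator (grHilbert I M) m h := by
  have hnt : Nontrivial M := by
    rw [← Module.supportDim_ne_bot_iff_nontrivial (R := S), hm]
    exact WithBot.coe_ne_bot
  have hIm := IsLocalRing.le_maximalIdeal hI
  have hfin := length_quotient_pow_ne_top hk
  obtain ⟨t, ht⟩ := IsNoetherian.noetherian I
  obtain ⟨p, hp⟩ := hilbertSerre_grHilbert (I := I) (M := M) t.toList ⊥
    (by simp [Ideal.ofList, ← ht, Ideal.span]) (by simp) hfin
  have hne : ∃ n, grHilbert I M n ≠ 0 := by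
    refine ⟨0, fun h0 => ?_⟩
    -- H(0) = 0 would mean IM = M, contradicting Nakayama's lemma.
    have h1 := iteratedHilbert_grHilbert_eq (I := I) (M := M) hfin 0
    rw [iteratedHilbert_one, Finset.sum_range_one, h0, Nat.cast_zero, eq_comm,
      Module.length_eq_zero_iff, Submodule.Quotient.subsingleton_iff, zero_add, pow_one] at h1
    refine top_ne_bot (α := Submodule S M) (Submodule.eq_bot_of_le_smul_of_le_jacobson_bot I ⊤
      Module.Finite.fg_top h1.ge ?_)
    rwa [IsLocalRing.jacobson_eq_maximalIdeal _ bot_ne_top]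
  obtain ⟨d, h, hd⟩ := exists_isHilbertNumerator hne hp
  have hmd : m ≤ d := by
    obtain ⟨C, hC⟩ := exists_iteratedHilbert_le hd.1
    have hgrowth : HilbertSamuelGrowth I M d := by
      refine ⟨C, fun n => ?_⟩
      refine (length_quotient_antitone (pow_succ_smul_top_le n)).trans ?_
      rw [← iteratedHilbert_grHilbert_eq hfin]
      exact_mod_cast hC n
    have := supportDim_le_of_hilbertSamuelGrowth hIm hgrowth
    rw [hm] at this
    exact_mod_cast this
  have hdm : d ≤ m := by
    obtain ⟨L, hL, hQm, r, hr⟩ := exists_system_of_parameters hm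
    set Q := Ideal.ofList L ⊔ Module.annihilator S M with hQ
    have hfinQ : ∀ n, Module.length S (M ⧸ (Q ^ n • (⊤ : Submodule S M))) ≠ ⊤ :=
      length_quotient_pow_ne_top (Submodule.smul_mono_left hr)
    -- The annihilator plays the role of J, so only the m parameters count towards the exponent.
    obtain ⟨q, hq⟩ := hilbertSerre_grHilbert (I := Q) (M := M) L _ hQ
      (Submodule.annihilator_top (R := S) (M := M) ▸ Submodule.annihilator_smul _) hfinQ
    rw [hL] at hq
    obtain ⟨C, hC⟩ := exists_iteratedHilbert_le hq
    -- The inclusions Q^(k(n+1)+1) M ≤ 𝔪^(k(n+1)) M ≤ Iⁿ⁺¹M give the comparison, and k(n+1) + 1 ≤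
    -- (k+1)(n+1) gives the constant.
    refine le_of_iteratedHilbert_le (C := C * (k + 1) ^ m) hd fun n => ?_
    have h1 : (iteratedHilbert (grHilbert I M) 1 n : ℕ∞) ≤
        iteratedHilbert (grHilbert Q M) 1 (k * (n + 1)) := by
      rw [iteratedHilbert_grHilbert_eq hfin, iteratedHilbert_grHilbert_eq hfinQ]
      refine length_quotient_antitone ?_
      refine le_trans ?_ (pow_smul_top_le_of_smul_top_le hk (n + 1))
      rw [← pow_mul]
      exact Submodule.smul_mono_left ((Ideal.pow_le_pow_right (Nat.le_succ _)).trans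
        (Ideal.pow_right_mono hQm _))
    have h2 : iteratedHilbert (grHilbert I M) 1 n ≤
        iteratedHilbert (grHilbert Q M) 1 (k * (n + 1)) := by exact_mod_cast h1
    refine h2.trans ((hC _).trans ?_)
    rw [mul_assoc, ← mul_pow]
    exact Nat.mul_le_mul_left _ (Nat.pow_le_pow_left (by nlinarith) m)
  exact ⟨h, le_antisymm hdm hmd ▸ hd⟩

end Parameters

/-! ### Residues and the identity theorem -/

section Residue

open Filter

theorem complexResidue_eq_of_eventuallyEq {f g : ℂ → ℂ} {a : ℂ} (hg : AnalyticAt ℂ g a)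
    (hf : ∀ᶠ z in 𝓝[≠] a, f z = (z - a)⁻¹ * g z) : complexResidue f a = g a := by
  refine Tendsto.limUnder_eq (tendsto_const_nhds.congr' ?_)
  have h1 : ∀ᶠ z in 𝓝 a, DifferentiableAt ℂ g z ∧ (z ≠ a → f z = (z - a)⁻¹ * g z) :=
    (hg.eventually_analyticAt.mono fun z hz => hz.differentiableAt).and
      (eventually_nhdsWithin_iff.1 hf)
  obtain ⟨ε, hε, hball⟩ := Metric.eventually_nhds_iff_ball.1 h1
  filter_upwards [Ioo_mem_nhdsGT hε] with r hr
  have hcl : Metric.closedBall a r ⊆ Metric.ball a ε := Metric.closedBall_subset_ball hr.2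
  have h2 : (∮ z in C(a, r), f z) = ∮ z in C(a, r), (z - a)⁻¹ • g z := by
    refine circleIntegral.integral_congr hr.1.le fun z hz => ?_
    rw [smul_eq_mul]
    exact (hball z (hcl (Metric.sphere_subset_closedBall hz))).2
      (Metric.ne_of_mem_sphere hz hr.1.ne')
  have h3 := DifferentiableOn.circleIntegral_sub_inv_smul (f := g) (c := a) (w := a) (R := r)
    (fun z hz => (hball z (hcl hz)).1.differentiableWithinAt) (Metric.mem_ball_self hr.1)
  rw [h2, h3, smul_eq_mul, inv_mul_cancel_left₀ Complex.two_pi_I_ne_zero]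

/-- Infinite order of f - g at one point propagates to every point, ℂ being connected. -/
theorem Meromorphic.eventuallyEq_nhdsNE_of_eventuallyEq {f g : ℂ → ℂ} (hf : Meromorphic f)
    (hg : Meromorphic g) {b : ℂ} (h : f =ᶠ[𝓝 b] g) (a : ℂ) : f =ᶠ[𝓝[≠] a] g := by
  have hfg : Meromorphic (f - g) := fun z => (hf z).sub (hg z)
  have hb : meromorphicOrderAt (f - g) b = ⊤ := by
    rw [meromorphicOrderAt_eq_top_iff]
    filter_upwards [h.filter_mono nhdsWithin_le_nhds] with z hz
    rw [Pi.sub_apply, hz, sub_self]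
  have ha : meromorphicOrderAt (f - g) a = ⊤ := by
    by_contra hne
    exact hfg.exists_meromorphicOrderAt_ne_top_iff_forall.1 ⟨a, hne⟩ b hb
  filter_upwards [meromorphicOrderAt_eq_top_iff.1 ha] with z hz
  exact sub_eq_zero.1 hz

end Residue

/-! ### Dirichlet series with eventually polynomial coefficients -/

section ShiftedZeta

open Filter

theorem eventually_riemannZeta_sub_eq (j : ℕ) (a : ℂ) :
    ∀ᶠ z in 𝓝[≠] a, riemannZeta (z - j) = (z - (j + 1))⁻¹ * riemannZeta₁ (z - j) := by
  have h : ∀ᶠ z in 𝓝[≠] a, z ≠ (j : ℂ) + 1 := by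
    rcases eq_or_ne a (j + 1) with rfl | ha
    · exact self_mem_nhdsWithin
    · exact (eventually_ne_nhds ha).filter_mono nhdsWithin_le_nhds
  filter_upwards [h] with z hz
  rw [riemannZeta_eq_inv_sub_mul (by rwa [Ne, sub_eq_iff_eq_add, add_comm]), sub_sub]

theorem meromorphic_riemannZeta_sub (j : ℕ) : Meromorphic fun z => riemannZeta (z - j) := by
  intro a
  have h : MeromorphicAt (fun z : ℂ => (z - (j + 1))⁻¹ * riemannZeta₁ (z - j)) a := by
    have h1 : Differentiable ℂ fun z => riemannZeta₁ (z - j) := by fun_prop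
    have h2 : Differentiable ℂ fun z : ℂ => z - (j + 1) := by fun_prop
    exact ((h2.analyticAt a).meromorphicAt.inv).mul (h1.analyticAt a).meromorphicAt
  exact h.congr ((eventually_riemannZeta_sub_eq j a).mono fun z hz => hz.symm)

/-- The meromorphic continuation of `∑ aₙ n⁻ᶻ`, where `aₙ = P(n)` for `n ≥ N`. -/
noncomputable def polynomialZeta (P : Polynomial ℂ) (N : ℕ) (a : ℕ → ℂ) (d : ℕ) (z : ℂ) : ℂ :=
  ∑ j ∈ Finset.range (d + 1), P.coeff j * riemannZeta (z - j) +
    ∑ n ∈ Finset.Ico 1 N, (a n - P.eval (n : ℂ)) / (n : ℂ) ^ z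

theorem differentiable_sum_div_natCast_cpow (N : ℕ) (c : ℕ → ℂ) :
    Differentiable ℂ fun z : ℂ => ∑ n ∈ Finset.Ico 1 N, c n / (n : ℂ) ^ z := by
  refine Differentiable.fun_sum fun n hn => ?_
  have hn0 : (n : ℂ) ≠ 0 := Nat.cast_ne_zero.2 (Nat.one_le_iff_ne_zero.1 (Finset.mem_Ico.1 hn).1)
  refine (differentiable_const _).fun_div (fun z => ?_) fun z => ?_
  · exact (differentiableAt_id.const_cpow (Or.inl hn0))
  · rw [Ne, Complex.cpow_eq_zero_iff]
    exact fun h => hn0 h.1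

theorem meromorphic_polynomialZeta (P : Polynomial ℂ) (N : ℕ) (a : ℕ → ℂ) (d : ℕ) :
    Meromorphic (polynomialZeta P N a d) := fun z =>
  (MeromorphicAt.fun_sum fun j _ => (MeromorphicAt.const _ z).fun_mul
    (meromorphic_riemannZeta_sub j z)).fun_add
      ((differentiable_sum_div_natCast_cpow N _).analyticAt z).meromorphicAt

theorem hasSum_polynomialZeta {P : Polynomial ℂ} {N : ℕ} {a : ℕ → ℂ} {d : ℕ}
    (hP : P.natDegree ≤ d) (ha : ∀ n, N ≤ n → a n = P.eval (n : ℂ)) {z : ℂ}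
    (hz : (d : ℝ) + 1 < z.re) :
    HasSum (fun n : ℕ => a n / (n : ℂ) ^ z) (polynomialZeta P N a d z) := by
  -- For z ≠ 0 one has 0 ^ z = 0, so every n = 0 term is a division by zero with value 0. This is
  -- why the finite correction starts at 1.
  have hz0 : z ≠ 0 := by
    rintro rfl
    rw [Complex.zero_re] at hz
    linarith [d.cast_nonneg (α := ℝ)]
  have hzeta : ∀ j ∈ Finset.range (d + 1),
      HasSum (fun n : ℕ => P.coeff j * ((n : ℂ) ^ j / (n : ℂ) ^ z))
        (P.coeff j * riemannZeta (z - j)) := by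
    intro j hj
    have hjd : (j : ℝ) ≤ d := by exact_mod_cast Nat.lt_succ_iff.1 (Finset.mem_range.1 hj)
    have hre : 1 < (z - j).re := by
      rw [Complex.sub_re, Complex.natCast_re]; linarith
    refine HasSum.mul_left _ ?_
    rw [zeta_eq_tsum_one_div_nat_cpow hre]
    refine ((Complex.summable_one_div_nat_cpow.2 hre).hasSum).congr_fun fun n => ?_
    rcases n.eq_zero_or_pos with rfl | hn
    · have hzj : z - j ≠ 0 := fun h0 => by
        rw [h0, Complex.zero_re] at hre
        linarith
      rw [Nat.cast_zero, Complex.zero_cpow hz0, Complex.zero_cpow hzj, div_zero, div_zero]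
    · have hn0 : (n : ℂ) ≠ 0 := by exact_mod_cast hn.ne'
      rw [Complex.cpow_sub _ _ hn0, Complex.cpow_natCast, one_div_div]
  have hfin : HasSum (fun n : ℕ => (a n - P.eval (n : ℂ)) / (n : ℂ) ^ z)
      (∑ n ∈ Finset.Ico 1 N, (a n - P.eval (n : ℂ)) / (n : ℂ) ^ z) := by
    refine hasSum_sum_of_ne_finset_zero fun n hn => ?_
    rcases n.eq_zero_or_pos with rfl | hn0
    · rw [Nat.cast_zero, Complex.zero_cpow hz0, div_zero]
    · have hNn : N ≤ n := by
        by_contra hlt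
        exact hn (Finset.mem_Ico.2 ⟨hn0, not_le.1 hlt⟩)
      rw [ha n hNn, sub_self, zero_div]
  refine ((hasSum_sum hzeta).add hfin).congr_fun fun n => ?_
  rw [Polynomial.eval_eq_sum_range' (Nat.lt_succ_of_le hP), sub_div, Finset.sum_div]
  simp only [mul_div_assoc]
  ring

/-- For j < d the pole j + 1 of ζ(z - j) lies outside the open unit ball about d + 1, so only the
term j = d is singular there; multiplying by z - (d+1) turns it into the entire function
`riemannZeta₁`, with value 1 at the pole. -/
theorem exists_residue_polynomialZeta (P : Polynomial ℂ) (N : ℕ) (a : ℕ → ℂ) (d : ℕ) :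
    ∃ g : ℂ → ℂ, AnalyticAt ℂ g (d + 1) ∧ g (d + 1) = P.coeff d ∧
      ∀ᶠ z in 𝓝[≠] ((d : ℂ) + 1), polynomialZeta P N a d z = (z - (d + 1))⁻¹ * g z := by
  have hEan : Differentiable ℂ fun z : ℂ => ∑ n ∈ Finset.Ico 1 N,
      (a n - P.eval (n : ℂ)) / (n : ℂ) ^ z := differentiable_sum_div_natCast_cpow N _
  have hLan : ∀ j ∈ Finset.range d,
      DifferentiableOn ℂ (fun z => P.coeff j * riemannZeta (z - j)) (Metric.ball ((d : ℂ) + 1) 1) := by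
    intro j hj z hz
    have hjd : (j : ℝ) + 1 ≤ d := by exact_mod_cast Finset.mem_range.1 hj
    have hne : z - j ≠ 1 := by
      intro h1
      have h2 : z - (d + 1) = ((j - d : ℝ) : ℂ) := by
        push_cast
        linear_combination h1
      rw [Metric.mem_ball, dist_eq_norm, h2, Complex.norm_real, Real.norm_eq_abs,
        abs_of_nonpos (by linarith)] at hz
      linarith
    have h3 : DifferentiableAt ℂ (fun z : ℂ => riemannZeta (z - j)) z :=
      (differentiableAt_riemannZeta hne).comp z (differentiableAt_id.sub_const _)
    exact (h3.const_mul _).differentiableWithinAt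
  refine ⟨fun z => P.coeff d * riemannZeta₁ (z - d) + (z - (d + 1)) *
    (∑ j ∈ Finset.range d, P.coeff j * riemannZeta (z - j) +
      ∑ n ∈ Finset.Ico 1 N, (a n - P.eval (n : ℂ)) / (n : ℂ) ^ z), ?_, ?_, ?_⟩
  · refine DifferentiableOn.analyticAt (s := Metric.ball ((d : ℂ) + 1) 1) ?_
      (Metric.ball_mem_nhds _ one_pos)
    have h1 : Differentiable ℂ fun z : ℂ => P.coeff d * riemannZeta₁ (z - d) := by fun_prop
    have h2 : Differentiable ℂ fun z : ℂ => z - (d + 1) := by fun_prop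
    exact h1.differentiableOn.fun_add (h2.differentiableOn.fun_mul
      ((DifferentiableOn.fun_sum hLan).fun_add hEan.differentiableOn))
  · simp
  · filter_upwards [eventually_riemannZeta_sub_eq d (d + 1), self_mem_nhdsWithin] with z hz hne
    have hz0 : z - (d + 1) ≠ 0 := sub_ne_zero.2 hne
    rw [polynomialZeta, Finset.sum_range_succ, hz]
    field_simp
    ring

end ShiftedZeta

/-! ### The limit w ↘ 0 and uniqueness of the continuation -/

section HigherZeta

open Filter

/-- Since H₁(0) = H(0), the subtracted H(0) w⁻ᶻ is exactly the n = 0 term. For n ≥ 1 and Re z > 0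
the terms at w > 0 are dominated by those at w = 0, so the limit may be taken termwise. -/
theorem isHigherZeta_of_hasSum {H : ℕ → ℕ} {Z : ℂ → ℂ} (hZ : Meromorphic Z) {σ : ℝ} (hσ : 0 ≤ σ)
    (hsum : ∀ z : ℂ, σ < z.re →
      HasSum (fun n : ℕ => (iteratedHilbert H 1 n : ℂ) / (n : ℂ) ^ z) (Z z)) :
    IsHigherZeta H 1 Z := by
  refine ⟨hZ, σ, fun z hz => ?_⟩
  have hz0 : z ≠ 0 := by
    rintro rfl
    rw [Complex.zero_re] at hz
    linarith
  have hs := hsum z hz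
  have hs1 : HasSum (fun n : ℕ => (iteratedHilbert H 1 (n + 1) : ℂ) / ((n + 1 : ℕ) : ℂ) ^ z)
      (Z z) := by
    refine (hasSum_nat_add_iff
      (f := fun n : ℕ => (iteratedHilbert H 1 n : ℂ) / (n : ℂ) ^ z) 1).2 ?_
    simpa [Complex.zero_cpow hz0] using hs
  have hbound : ∀ w : ℝ, 0 < w → ∀ n : ℕ, ‖zetaBarnesTerm H 1 z w (n + 1)‖ ≤
      ‖(iteratedHilbert H 1 (n + 1) : ℂ) / ((n + 1 : ℕ) : ℂ) ^ z‖ := by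
    intro w hw n
    unfold zetaBarnesTerm
    have h1 : (((n + 1 : ℕ) : ℂ) + (w : ℂ)) = (((n + 1 : ℕ) : ℝ) + w : ℝ) := by push_cast; rfl
    have h2 : ((n + 1 : ℕ) : ℂ) = (((n + 1 : ℕ) : ℝ) : ℂ) := by push_cast; rfl
    rw [h1, norm_div, norm_div, Complex.norm_cpow_eq_rpow_re_of_pos (by positivity), h2,
      Complex.norm_cpow_eq_rpow_re_of_pos (by positivity)]
    gcongr
    · linarith
    · linarith
  have hsummable : ∀ w : ℝ, 0 < w → Summable (zetaBarnesTerm H 1 z w) := fun w hw => by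
    rw [← summable_nat_add_iff 1]
    exact Summable.of_norm_bounded hs1.summable.norm (hbound w hw)
  refine ⟨hsummable, ?_⟩
  have hlim : Tendsto (fun w : ℝ => ∑' n, zetaBarnesTerm H 1 z w (n + 1)) (𝓝[>] 0) (𝓝 (Z z)) := by
    rw [← hs1.tsum_eq]
    refine tendsto_tsum_of_dominated_convergence hs1.summable.norm (fun n => ?_) ?_
    · unfold zetaBarnesTerm
      have hcont : ContinuousAt (fun w : ℝ => (iteratedHilbert H 1 (n + 1) : ℂ) /
          (((n + 1 : ℕ) : ℂ) + (w : ℂ)) ^ z) 0 := by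
        have hslit : ((n + 1 : ℕ) : ℂ) + ((0 : ℝ) : ℂ) ∈ Complex.slitPlane := by
          rw [Complex.ofReal_zero, add_zero]
          exact Complex.natCast_mem_slitPlane.2 n.succ_ne_zero
        refine continuousAt_const.div ?_ ?_
        · exact (ContinuousAt.cpow (by fun_prop) continuousAt_const hslit)
        · rw [Ne, Complex.cpow_eq_zero_iff]
          exact fun h0 => Complex.slitPlane_ne_zero hslit h0.1
      have := hcont.tendsto.mono_left (nhdsWithin_le_nhds (s := Set.Ioi 0))
      simpa using this
    · filter_upwards [self_mem_nhdsWithin] with w hw n using hbound w hw n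
  refine hlim.congr' ?_
  filter_upwards [self_mem_nhdsWithin] with w hw
  rw [zetaBarnes, (hsummable w hw).tsum_eq_zero_add]
  simp [zetaBarnesTerm, iteratedHilbert_one, Complex.cpow_neg, div_eq_mul_inv]

theorem IsHigherZeta.eventuallyEq_nhdsNE {H : ℕ → ℕ} {i : ℕ} {Z Z' : ℂ → ℂ}
    (h : IsHigherZeta H i Z) (h' : IsHigherZeta H i Z') (a : ℂ) : Z =ᶠ[𝓝[≠] a] Z' := by
  obtain ⟨σ, hσ⟩ := h.eq_lim
  obtain ⟨σ', hσ'⟩ := h'.eq_lim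
  refine h.meromorphic.eventuallyEq_nhdsNE_of_eventuallyEq h'.meromorphic
    (b := ((max σ σ' + 1 : ℝ) : ℂ)) ?_ a
  have hopen : IsOpen {z : ℂ | max σ σ' < z.re} := isOpen_lt continuous_const Complex.continuous_re
  filter_upwards [hopen.mem_nhds (show ((max σ σ' + 1 : ℝ) : ℂ) ∈ {z : ℂ | max σ σ' < z.re} from
    lt_add_one (max σ σ'))] with z hz
  exact tendsto_nhds_unique (hσ z ((le_max_left _ _).trans_lt hz)).2
    (hσ' z ((le_max_right _ _).trans_lt hz)).2

end HigherZeta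
theorem proposition4p1 {S : Type*} [CommRing S] [IsLocalRing S] [IsNoetherianRing S]
    {M : Type*} [AddCommGroup M] [Module S M] [Module.Finite S M]
    (m : ℕ) (hm : Module.supportDim S M = (m : WithBot ℕ∞))
    (I : Ideal S) (hI : I ≠ ⊤)
    (hIM : ∃ n : ℕ, 1 ≤ n ∧
      IsLocalRing.maximalIdeal S ^ n • (⊤ : Submodule S M) ≤ I • (⊤ : Submodule S M)) :
    (∀ n : ℕ, Module.length S (GrPiece I M n) ≠ ⊤) ∧
    (∃ h : Polynomial ℤ, IsHilbertNumerator (grHilbert I M) m h) ∧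
    (∃ Z : ℂ → ℂ, IsHigherZeta (grHilbert I M) 1 Z) ∧
    (∀ Z : ℂ → ℂ, IsHigherZeta (grHilbert I M) 1 Z →
      (multiplicityWrt I M : ℂ) =
        (m.factorial : ℂ) * complexResidue Z ((m : ℂ) + 1)) := by
  obtain ⟨k, -, hk⟩ := hIM
  obtain ⟨h, hh⟩ := exists_isHilbertNumerator_grHilbert hm hI hk
  obtain ⟨P, hdeg, hcoeff, N, hN⟩ := exists_hilbertSamuel_polynomial ℂ hh.1
  have hZ₀ : IsHigherZeta (grHilbert I M) 1
      (polynomialZeta P N (fun n => iteratedHilbert (grHilbert I M) 1 n) m) :=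
    isHigherZeta_of_hasSum (meromorphic_polynomialZeta _ _ _ _) (σ := m + 1) (by positivity)
      fun z hz => hasSum_polynomialZeta hdeg hN hz
  refine ⟨length_grPiece_ne_top (length_quotient_pow_ne_top hk), ⟨h, hh⟩, ⟨_, hZ₀⟩, fun Z hZ => ?_⟩
  obtain ⟨g, hg, hgm, hgZ⟩ := exists_residue_polynomialZeta P N
    (fun n => (iteratedHilbert (grHilbert I M) 1 n : ℂ)) m
  have hZg : ∀ᶠ z in 𝓝[≠] ((m : ℂ) + 1), Z z = (z - (m + 1))⁻¹ * g z := by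
    filter_upwards [hZ.eventuallyEq_nhdsNE hZ₀ ((m : ℂ) + 1), hgZ] with z h1 h2
    rw [h1, h2]
  have hfac : (m.factorial : ℂ) ≠ 0 := by exact_mod_cast m.factorial_ne_zero
  rw [complexResidue_eq_of_eventuallyEq hg hZg, hgm, hcoeff, multiplicityWrt,
    hh.hilbertMultiplicity_eq, mul_div_cancel₀ _ hfac]
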